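/- Let $x\mapsto s(t)A(t)x+d(t)$ be a $C^1$ one-parameter equiform motion of $\mathbf E^7$, defined on an open interval around $t=0$, with $s(t)>0$, $A(t)\in SO(7)$, $s(0)=1$, $A(0)=I$, $d(0)=0$. Put $s'=\dot s(0)$, $\Omega=\dot A(0)$, $d'=\dot d(0)=(b'_1,\dots,b'_7)^T$, and let $\omega_1,\dots,\omega_{21}$ be the entries of the skew-symmetric matrix $\Omega$ above the diagonal, read row by row. The kinematic 3-surface of the unit sphere $\mathbf x(\theta,\phi)=(\cos\theta\cos\phi,\sin\theta\cos\phi,\sin\phi,0,0,0,0)^T$ is $$\mathbf X(t,\theta,\phi)=\big[I+t(s'I+\Omega)\big]\mathbf x(\theta,\phi)+t\,d'.$$ Assume that it is foliated by spheres, i.e. $$\sum_{i=2}^{6}\omega_i\omega_{i+5}=\omega_1\omega_7-\sum_{i=3}^{6}\omega_i\omega_{i+9}=\omega_1\omega_2+\sum_{i=8}^{11}\omega_i\omega_{i+4}=0,$$ $$\sum_{i=2}^{6}\omega_i^2=\sum_{i=7}^{11}\omega_i^2,\qquad \omega_1^2+\sum_{i=3}^{6}\omega_i^2=\omega_7^2+\sum_{i=12}^{15}\omega_i^2,$$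 and that $b'_1=b'_2=b'_3=0$. Let $g_{ij}$ be the first fundamental form of $\mathbf X$ in the coordinates $(x_1,x_2,x_3)=(t,\theta,\phi)$, $\Gamma_{ij}^l$ its Christoffel symbols, and let $$\mathbf K(t,\theta,\phi)=g^{ij}\big[\partial_l\Gamma_{ij}^l-\partial_j\Gamma_{il}^l+\Gamma_{ij}^l\Gamma_{lm}^m-\Gamma_{il}^m\Gamma_{jm}^l\big]$$ be its scalar curvature. Suppose that at the zero position $t=0$ the parametrization has a regular point (one with $\det(g_{ij})\ne0$) and that $\mathbf K(0,\theta,\phi)$ equals a constant $\mathbf K$ at all regular points. Then $$\omega_1=\omega_2=\omega_7=0,\qquad \sum_{i=4}^{7}b'_i\omega_{i-1}=\sum_{i=4}^{7}b'_i\omega_{i+4}=\sum_{i=4}^{7}b'_i\omega_{i+8}=0,$$ $s'^2+\sum_{i=3}^{6}\omega_i^2+\sum_{i=4}^{7}b_i'^2>0$, and $$\mathbf K=\frac{2\big[\sum_{i=4}^{7}b_i'^2-\sum_{i=3}^{6}\omega_i^2\big]}{s'^2+\sum_{i=3}^{6}\omega_i^2+\sum_{i=4}^{7}b_i'^2}.$$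 -/

import Mathlib

noncomputable section

namespace Kinematic

open Matrix

/-! ### Curvature of a parametrized 3-surface, in coordinates -/

/-- The partial derivative of `F` with respect to the `k`-th coordinate at `p`. -/
def pd {E : Type*} [NormedAddCommGroup E] [NormedSpace ℝ E]
    (k : Fin 3) (F : (Fin 3 → ℝ) → E) (p : Fin 3 → ℝ) : E :=
  deriv (fun r : ℝ => F (Function.update p k r)) (p k)

/-- The first fundamental form `g_{ij} = X_i · X_j` of a parametrized 3-surface in `E⁷`. -/
def firstForm (X : (Fin 3 → ℝ) → (Fin 7 → ℝ)) (p : Fin 3 → ℝ) : Matrix (Fin 3) (Fin 3) ℝ :=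
  Matrix.of fun i j => pd i X p ⬝ᵥ pd j X p

/-- The Christoffel symbol of the second kind `Γ^l_{ij}` of the metric `g`. -/
def christoffel (g : (Fin 3 → ℝ) → Matrix (Fin 3) (Fin 3) ℝ) (l i j : Fin 3)
    (p : Fin 3 → ℝ) : ℝ :=
  (1 / 2) * ∑ m, (g p)⁻¹ l m *
    (pd j (fun q => g q i m) p + pd i (fun q => g q j m) p - pd m (fun q => g q i j) p)

/-- The scalar curvature of the metric `g`. -/
def scalarCurvature (g : (Fin 3 → ℝ) → Matrix (Fin 3) (Fin 3) ℝ) (p : Fin 3 → ℝ) : ℝ :=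
  ∑ i, ∑ j, (g p)⁻¹ i j * ∑ l,
    (pd l (christoffel g l i j) p - pd j (christoffel g l i l) p
      + ∑ m, (christoffel g l i j p * christoffel g m l m p
        - christoffel g m i l p * christoffel g l j m p))

/-! ### Equiform motions and their kinematic surfaces -/

/-- A `C¹` one-parameter equiform motion `x ↦ s(t) A(t) x + d(t)` of Euclidean 7-space, on an
open time interval containing `0`, at which the moving and the fixed frame coincide. -/
structure EquiformMotion where
  /-- the time interval -/
  I : Set ℝ
  /-- the scaling factor -/
  s : ℝ → ℝ
  /-- the rotation part -/
  A : ℝ → Matrix (Fin 7) (Fin 7) ℝ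
  /-- the position of the origin of the moving space -/
  d : ℝ → Fin 7 → ℝ
  isOpen_I : IsOpen I
  ordConnected_I : I.OrdConnected
  zero_mem : (0 : ℝ) ∈ I
  s_pos : ∀ t ∈ I, 0 < s t
  A_mem : ∀ t ∈ I, A t ∈ Matrix.specialOrthogonalGroup (Fin 7) ℝ
  contDiff_s : ContDiffOn ℝ 1 s I
  contDiff_A : ∀ i j, ContDiffOn ℝ 1 (fun t => A t i j) I
  contDiff_d : ∀ i, ContDiffOn ℝ 1 (fun t => d t i) I
  s_zero : s 0 = 1
  A_zero : A 0 = 1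
  d_zero : d 0 = 0

/-- The unit sphere of the space of the first three coordinates. -/
def sphere (θ φ : ℝ) : Fin 7 → ℝ :=
  ![Real.cos θ * Real.cos φ, Real.sin θ * Real.cos φ, Real.sin φ, 0, 0, 0, 0]

namespace EquiformMotion

variable (M : EquiformMotion)

/-- `s' = ds/dt (0)`. -/
def s' : ℝ := deriv M.s 0

/-- `Ω = dA/dt (0)`. -/
def Ω : Matrix (Fin 7) (Fin 7) ℝ := Matrix.of fun i j => deriv (fun t => M.A t i j) 0

/-- `d' = dd/dt (0)`. -/
def d' : Fin 7 → ℝ := fun i => deriv (fun t => M.d t i) 0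

/-- The numbers `ω₁, …, ω₂₁`: the entries of `Ω` above the diagonal, row by row. -/
def ω : ℕ → ℝ
  | 1 => M.Ω 0 1
  | 2 => M.Ω 0 2
  | 3 => M.Ω 0 3
  | 4 => M.Ω 0 4
  | 5 => M.Ω 0 5
  | 6 => M.Ω 0 6
  | 7 => M.Ω 1 2
  | 8 => M.Ω 1 3
  | 9 => M.Ω 1 4
  | 10 => M.Ω 1 5
  | 11 => M.Ω 1 6
  | 12 => M.Ω 2 3
  | 13 => M.Ω 2 4
  | 14 => M.Ω 2 5
  | 15 => M.Ω 2 6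
  | 16 => M.Ω 3 4
  | 17 => M.Ω 3 5
  | 18 => M.Ω 3 6
  | 19 => M.Ω 4 5
  | 20 => M.Ω 4 6
  | 21 => M.Ω 5 6
  | _ => 0

/-- The numbers `b'₁, …, b'₇`: the coordinates of `d'`. -/
def b' : ℕ → ℝ
  | 1 => M.d' 0
  | 2 => M.d' 1
  | 3 => M.d' 2
  | 4 => M.d' 3
  | 5 => M.d' 4
  | 6 => M.d' 5
  | 7 => M.d' 6
  | _ => 0

/-- The kinematic 3-surface: the points `[I + t (s' I + Ω)] x(θ, φ) + t d'` traced by the unit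
sphere under the motion up to first order; the coordinates are `p = (t, θ, φ)`. -/
def surface (p : Fin 3 → ℝ) : Fin 7 → ℝ :=
  (1 + p 0 • (M.s' • (1 : Matrix (Fin 7) (Fin 7) ℝ) + M.Ω)) *ᵥ sphere (p 1) (p 2) + p 0 • M.d'

/-- The surface is foliated by spheres: the three axis vectors of the (a priori) ellipsoids
`t = const` are orthogonal and of equal length, for all `t`. -/
structure FoliatedBySpheres : Prop where
  orth₀₁ : ∑ i ∈ Finset.Icc 2 6, M.ω i * M.ω (i + 5) = 0
  orth₀₂ : M.ω 1 * M.ω 7 - ∑ i ∈ Finset.Icc 3 6, M.ω i * M.ω (i + 9) = 0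
  orth₁₂ : M.ω 1 * M.ω 2 + ∑ i ∈ Finset.Icc 8 11, M.ω i * M.ω (i + 4) = 0
  norm₀₁ : ∑ i ∈ Finset.Icc 2 6, M.ω i ^ 2 = ∑ i ∈ Finset.Icc 7 11, M.ω i ^ 2
  norm₀₂ : M.ω 1 ^ 2 + ∑ i ∈ Finset.Icc 3 6, M.ω i ^ 2
    = M.ω 7 ^ 2 + ∑ i ∈ Finset.Icc 12 15, M.ω i ^ 2

/-- The parametrization is regular at the point `(0, θ, φ)` of the zero position. -/
def RegularAt (θ φ : ℝ) : Prop := (firstForm M.surface ![0, θ, φ]).det ≠ 0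

/-- The surface has constant scalar curvature `K` at the zero position `t = 0`: there are regular
points there, and the scalar curvature is `K` at all of them. -/
def HasConstantScalarCurvature (K : ℝ) : Prop :=
  (∃ θ φ, M.RegularAt θ φ) ∧
    ∀ θ φ, M.RegularAt θ φ → scalarCurvature (firstForm M.surface) ![0, θ, φ] = K

end EquiformMotion

end Kinematic

end

/-!
The surface is seen through a few invariants of the motion. Let `w` be the axial vector of the
restriction of `Ω` to the space of the first three coordinates, let `v = (Ω eᵢ · d')ᵢ`, and let `c`
be the common squared length of `Ω e₁`, `Ω e₂`, `Ω e₃`. With `N = s'² + c` and `E = N + |d'|²` the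
first fundamental form is
`(E + 2 v · x) dt² + 2 dt (w × x + t v) · dx + (1 + 2 s' t + N t²) dx · dx`
on the product of the time axis with the unit sphere
(`Kinematic.EquiformMotion.firstForm_surface`).

The scalar curvature of a metric in three coordinates is the contraction of six components of the
curvature tensor with the minors of the inverse metric (`Kinematic.scalarCurvature_eq_minors`).
Evaluated in the moving frame of the sphere, it is at `t = 0` a polynomial in `x` divided by the
square of `u = E + 2 v · x - |w × x|²` (`Kinematic.scalarCurvature_modelMetric`). If it is a
constant `K` at all regular points, then the resulting equation holds on the whole sphere by
analytic continuation (`Kinematic.curvatureEquation_of_regular`).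

Comparison of coefficients along great circles shows `w = 0`
(`Kinematic.axial_eq_zero_of_curvatureEquation`): otherwise `K = 6` and
`E - |w|² = -2 N - s'²`, which is excluded by `2 |w|² ≤ 3 c`. In the same way `v = 0`
(`Kinematic.drift_eq_zero_of_curvatureEquation`): otherwise `K = 3 / 2`, `|d'|² = 3 c + s'²` and
`E² = 4 |v|²`, and the Cauchy–Schwarz inequality `|v|² ≤ c |d'|²` then forces `c = 0`. For
`v = w = 0` the equation reads `(K - 2) E² = -(4 N - 2 s'²) E`, and `E ≠ 0` at a regular point.
-/

namespace Kinematic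

open Matrix

/-! ### Scalar curvature of a metric in three coordinates -/

theorem differentiableAt_matrix_det {n : Type*} [Fintype n] [DecidableEq n]
    {a : ℝ → Matrix n n ℝ} {r₀ : ℝ} (ha : ∀ i j, DifferentiableAt ℝ (fun r => a r i j) r₀) :
    DifferentiableAt ℝ (fun r => (a r).det) r₀ := by
  simp only [Matrix.det_apply]
  refine DifferentiableAt.fun_sum fun σ _ => ?_
  exact (DifferentiableAt.fun_finsetProd fun i _ => ha _ _).const_smul _

theorem differentiableAt_matrix_inv {n : Type*} [Fintype n] [DecidableEq n]
    {a : ℝ → Matrix n n ℝ} {r₀ : ℝ} (ha : ∀ i j, DifferentiableAt ℝ (fun r => a r i j) r₀)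
    (hdet : (a r₀).det ≠ 0) (i j : n) : DifferentiableAt ℝ (fun r => (a r)⁻¹ i j) r₀ := by
  simp only [Matrix.inv_def, Ring.inverse_eq_inv', Matrix.smul_apply, smul_eq_mul,
    Matrix.adjugate_apply]
  refine ((differentiableAt_matrix_det ha).inv hdet).mul (differentiableAt_matrix_det fun k l => ?_)
  by_cases h : k = j
  · subst h; simp
  · simpa [Matrix.updateRow_ne h] using ha k l

/-- The derivative of the inverse matrix is `-a⁻¹ a' a⁻¹`, entry by entry. -/
theorem hasDerivAt_matrix_inv {n : Type*} [Fintype n] [DecidableEq n]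
    {a : ℝ → Matrix n n ℝ} {a' : Matrix n n ℝ} {r₀ : ℝ}
    (ha : ∀ i j, HasDerivAt (fun r => a r i j) (a' i j) r₀)
    (hdet : (a r₀).det ≠ 0) (i j : n) :
    HasDerivAt (fun r => (a r)⁻¹ i j) (-((a r₀)⁻¹ * a' * (a r₀)⁻¹) i j) r₀ := by
  have hd := differentiableAt_matrix_inv (fun i j => (ha i j).differentiableAt) hdet
  set b' : Matrix n n ℝ := Matrix.of fun i j => deriv (fun r => (a r)⁻¹ i j) r₀ with hb'
  have hb : ∀ i j, HasDerivAt (fun r => (a r)⁻¹ i j) (b' i j) r₀ := fun i j =>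
    (hd i j).hasDerivAt
  -- differentiate `a⁻¹ * a = 1`, which holds near `r₀`
  have hunit : ∀ᶠ r in nhds r₀, (a r).det ≠ 0 :=
    (differentiableAt_matrix_det fun i j =>
      (ha i j).differentiableAt).continuousAt.eventually_ne hdet
  have hzero : b' * a r₀ + (a r₀)⁻¹ * a' = 0 := by
    ext i j
    have h1 : HasDerivAt (fun r => ((a r)⁻¹ * a r) i j)
        ((b' * a r₀ + (a r₀)⁻¹ * a') i j) r₀ := by
      simp only [Matrix.mul_apply, Matrix.add_apply, ← Finset.sum_add_distrib]
      exact HasDerivAt.fun_sum fun k _ => (hb i k).mul (ha k j)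
    have h2 : (fun r => ((a r)⁻¹ * a r) i j) =ᶠ[nhds r₀] fun _ => (1 : Matrix n n ℝ) i j := by
      filter_upwards [hunit] with r hr
      rw [Matrix.nonsing_inv_mul _ (isUnit_iff_ne_zero.mpr hr)]
    exact h1.unique ((hasDerivAt_const r₀ _).congr_of_eventuallyEq h2)
  have hb'' : b' = -((a r₀)⁻¹ * a' * (a r₀)⁻¹) := by
    have := congrArg (· * (a r₀)⁻¹) hzero
    simp only [add_mul, zero_mul, Matrix.mul_assoc,
      Matrix.mul_nonsing_inv _ (isUnit_iff_ne_zero.mpr hdet), Matrix.mul_one] at this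
    rw [Matrix.mul_assoc]
    exact eq_neg_of_add_eq_zero_left this
  rw [← Matrix.neg_apply, ← hb'']
  exact hb i j

/-- Twice the Christoffel symbol of the first kind `[ij, m]`, where `D k i j = ∂ₖ gᵢⱼ`. -/
noncomputable def christoffelLower (D : Fin 3 → Fin 3 → Fin 3 → ℝ) (i j m : Fin 3) : ℝ :=
  D j i m + D i j m - D m i j

/-- The covariant curvature tensor in terms of the inverse metric `h`, the first derivatives
`D k i j = ∂ₖ gᵢⱼ` and the second derivatives `S l k i j = ∂ₗ ∂ₖ gᵢⱼ`; the order of the indices is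
such that the scalar curvature is the contraction `hⁱʲ hˡᵐ R m i l j`. -/
noncomputable def lowerRiemann (h : Matrix (Fin 3) (Fin 3) ℝ) (D : Fin 3 → Fin 3 → Fin 3 → ℝ)
    (S : Fin 3 → Fin 3 → Fin 3 → Fin 3 → ℝ) (m i l j : Fin 3) : ℝ :=
  (1 / 2) * (S l i j m - S l m i j - S j i l m + S j m i l)
    - (1 / 4) * ∑ a, ∑ b, h a b *
      (christoffelLower D l m b * christoffelLower D i j a
        - christoffelLower D j m b * christoffelLower D i l a)

section

variable {g : (Fin 3 → ℝ) → Matrix (Fin 3) (Fin 3) ℝ}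
  {D : Fin 3 → Fin 3 → Fin 3 → (Fin 3 → ℝ) → ℝ} {S : Fin 3 → Fin 3 → Fin 3 → Fin 3 → ℝ}

theorem pd_eq_of_hasDerivAt {F : (Fin 3 → ℝ) → ℝ} {k : Fin 3} {p : Fin 3 → ℝ} {c : ℝ}
    (h : HasDerivAt (fun r => F (Function.update p k r)) c (p k)) : pd k F p = c :=
  h.deriv

theorem christoffel_eq
    (hD : ∀ k i j p, HasDerivAt (fun r => g (Function.update p k r) i j) (D k i j p) (p k))
    (l i j : Fin 3) (p : Fin 3 → ℝ) :
    christoffel g l i j p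
      = (1 / 2) * ∑ m, (g p)⁻¹ l m * christoffelLower (fun k i j => D k i j p) i j m := by
  have h : ∀ k i j, pd k (fun q => g q i j) p = D k i j p := fun k i j =>
    pd_eq_of_hasDerivAt (hD k i j p)
  simp only [christoffel, christoffelLower, h]

/-- The derivative of a Christoffel symbol: the product rule together with `∂ h = -h (∂ g) h` for
the inverse metric `h`. -/
theorem pd_christoffel_eq
    (hD : ∀ k i j p, HasDerivAt (fun r => g (Function.update p k r) i j) (D k i j p) (p k))
    {p : Fin 3 → ℝ}
    (hS : ∀ l k i j, HasDerivAt (fun r => D k i j (Function.update p l r)) (S l k i j) (p l))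
    (hdet : (g p).det ≠ 0) (k l i j : Fin 3) :
    pd k (christoffel g l i j) p
      = (1 / 2) * ∑ m, ((g p)⁻¹ l m * christoffelLower (S k) i j m
        - (∑ a, ∑ b, (g p)⁻¹ l b * D k b a p * (g p)⁻¹ a m)
          * christoffelLower (fun k i j => D k i j p) i j m) := by
  apply pd_eq_of_hasDerivAt
  simp only [christoffel_eq hD]
  refine (HasDerivAt.fun_sum fun m _ => ?_).const_mul _
  have hinv := hasDerivAt_matrix_inv (a := fun r => g (Function.update p k r))
    (a' := Matrix.of fun i j => D k i j p) (r₀ := p k) (fun i j => hD k i j p)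
    (by simpa using hdet) l m
  have hC : HasDerivAt
      (fun r => christoffelLower (fun k' i j => D k' i j (Function.update p k r)) i j m)
      (christoffelLower (S k) i j m) (p k) :=
    ((hS k j i m).add (hS k i j m)).sub (hS k m i j)
  refine (hinv.mul hC).congr_deriv ?_
  simp only [Function.update_eq_self, Matrix.mul_apply, Matrix.of_apply, Finset.sum_mul,
    neg_mul, add_comm, sub_eq_add_neg]

/-- Christoffel symbols are eliminated from the scalar curvature: it is the full contraction of the
covariant curvature tensor. -/
theorem scalarCurvature_eq_sum_lowerRiemann
    (hD : ∀ k i j p, HasDerivAt (fun r => g (Function.update p k r) i j) (D k i j p) (p k))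
    {p : Fin 3 → ℝ}
    (hS : ∀ l k i j, HasDerivAt (fun r => D k i j (Function.update p l r)) (S l k i j) (p l))
    (hdet : (g p).det ≠ 0) (hsymm : ∀ i j, (g p)⁻¹ i j = (g p)⁻¹ j i)
    (hDsymm : ∀ k i j, D k i j p = D k j i p) (hSsymm : ∀ l k i j, S l k i j = S k l i j) :
    scalarCurvature g p = ∑ i, ∑ j, (g p)⁻¹ i j * ∑ l, ∑ m, (g p)⁻¹ l m *
      lowerRiemann (g p)⁻¹ (fun k i j => D k i j p) S m i l j := by
  unfold scalarCurvature
  refine Finset.sum_congr rfl fun i _ => Finset.sum_congr rfl fun j _ => ?_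
  congr 1
  simp only [pd_christoffel_eq hD hS hdet, christoffel_eq hD, lowerRiemann]
  generalize hh : (g p)⁻¹ = h at hsymm ⊢
  set C := christoffelLower (fun k i j => D k i j p) with hC
  have hCsymm : ∀ i j m, C i j m = C j i m := fun i j m => by
    simp only [hC, christoffelLower, hDsymm m i j]; ring
  -- `∂ₖ gᵢⱼ = [ki, j] + [kj, i]`
  have hDC : ∀ k i j, D k i j p = (1 / 2) * (C k i j + C k j i) := fun k i j => by
    simp only [hC, christoffelLower, hDsymm k j i, hDsymm i k j, hDsymm j k i]; ring
  -- the two copies of `∂ₗ ∂ⱼ gᵢₘ` cancel in `∂ₗ [ij, m] - ∂ⱼ [il, m]`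
  have hS0 : ∀ l m, christoffelLower (S l) i j m - christoffelLower (S j) i l m
      = S l i j m - S l m i j - S j i l m + S j m i l := fun l m => by
    simp only [christoffelLower, hSsymm l j]; ring
  simp only [← hS0, hDC]
  generalize hT : (fun k => christoffelLower (S k)) = T
  have hT' : ∀ k, christoffelLower (S k) = T k := fun k => by rw [← hT]
  simp only [hT']
  clear_value C
  simp only [Fin.sum_univ_three, hsymm 1 0, hsymm 2 0, hsymm 2 1, hCsymm 1 0, hCsymm 2 0,
    hCsymm 2 1]
  ring

theorem lowerRiemann_swap_right (h : Matrix (Fin 3) (Fin 3) ℝ) (D : Fin 3 → Fin 3 → Fin 3 → ℝ)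
    (S : Fin 3 → Fin 3 → Fin 3 → Fin 3 → ℝ) (m i l j : Fin 3) :
    lowerRiemann h D S m i j l = -lowerRiemann h D S m i l j := by
  simp only [lowerRiemann, Fin.sum_univ_three]
  ring

theorem lowerRiemann_swap_pairs {h : Matrix (Fin 3) (Fin 3) ℝ} (hh : ∀ i j, h i j = h j i)
    {D : Fin 3 → Fin 3 → Fin 3 → ℝ} (hD : ∀ k i j, D k i j = D k j i)
    (hS : ∀ l k i j, S l k i j = S k l i j) (hS' : ∀ l k i j, S l k i j = S l k j i)
    (m i l j : Fin 3) : lowerRiemann h D S l j m i = lowerRiemann h D S m i l j := by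
  have hC : ∀ i j m, christoffelLower D i j m = christoffelLower D j i m := fun i j m => by
    simp only [christoffelLower, hD m i j]; ring
  simp only [lowerRiemann, Fin.sum_univ_three, hh 1 0, hh 2 0, hh 2 1, hC j i, hC m l]
  have h1 : S i l j m = S l i j m := hS i l j m
  have h2 : S m l j i = S l m i j := by rw [hS m l j i, hS' l m j i]
  have h3 : S i j m l = S j i l m := by rw [hS i j m l, hS' j i m l]
  have h4 : S m j i l = S j m i l := hS m j i l
  linear_combination (1 / 2) * (h1 - h2 - h3 + h4)

theorem lowerRiemann_swap_left {h : Matrix (Fin 3) (Fin 3) ℝ} (hh : ∀ i j, h i j = h j i)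
    {D : Fin 3 → Fin 3 → Fin 3 → ℝ} (hD : ∀ k i j, D k i j = D k j i)
    (hS : ∀ l k i j, S l k i j = S k l i j) (hS' : ∀ l k i j, S l k i j = S l k j i)
    (m i l j : Fin 3) : lowerRiemann h D S i m l j = -lowerRiemann h D S m i l j := by
  rw [lowerRiemann_swap_pairs hh hD hS hS' l j i m, lowerRiemann_swap_right,
    lowerRiemann_swap_pairs hh hD hS hS']

/-- In dimension three the contraction runs over the six components of the curvature tensor that
are independent under its symmetries; their coefficients are the `2 × 2` minors of the inverse
metric. -/
theorem scalarCurvature_eq_minors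
    (hD : ∀ k i j p, HasDerivAt (fun r => g (Function.update p k r) i j) (D k i j p) (p k))
    {p : Fin 3 → ℝ}
    (hS : ∀ l k i j, HasDerivAt (fun r => D k i j (Function.update p l r)) (S l k i j) (p l))
    (hdet : (g p).det ≠ 0) {h : Matrix (Fin 3) (Fin 3) ℝ} (hinv : (g p)⁻¹ = h)
    (hsymm : ∀ i j, h i j = h j i)
    (hDsymm : ∀ k i j, D k i j p = D k j i p) (hSsymm : ∀ l k i j, S l k i j = S k l i j)
    (hSsymm' : ∀ l k i j, S l k i j = S l k j i) :
    scalarCurvature g p =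
      2 * ((h 0 0 * h 1 1 - h 0 1 ^ 2) * lowerRiemann h (fun k i j => D k i j p) S 0 1 0 1
        + (h 0 0 * h 2 2 - h 0 2 ^ 2) * lowerRiemann h (fun k i j => D k i j p) S 0 2 0 2
        + (h 1 1 * h 2 2 - h 1 2 ^ 2) * lowerRiemann h (fun k i j => D k i j p) S 1 2 1 2
        + 2 * (h 0 0 * h 1 2 - h 0 1 * h 0 2)
          * lowerRiemann h (fun k i j => D k i j p) S 0 1 0 2
        + 2 * (h 0 1 * h 1 2 - h 0 2 * h 1 1)
          * lowerRiemann h (fun k i j => D k i j p) S 0 1 1 2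
        + 2 * (h 0 1 * h 2 2 - h 0 2 * h 1 2)
          * lowerRiemann h (fun k i j => D k i j p) S 0 2 1 2) := by
  rw [scalarCurvature_eq_sum_lowerRiemann hD hS hdet (hinv ▸ hsymm) hDsymm hSsymm, hinv]
  have hr := lowerRiemann_swap_right h (fun k i j => D k i j p) S
  have hl := lowerRiemann_swap_left hsymm hDsymm hSsymm hSsymm'
  have hp := lowerRiemann_swap_pairs hsymm hDsymm hSsymm hSsymm'
  generalize lowerRiemann h (fun k i j => D k i j p) S = R at hr hl hp ⊢
  have hr0 : ∀ m i l, R m i l l = 0 := fun m i l => by linarith [hr m i l l]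
  have hl0 : ∀ m l j, R m m l j = 0 := fun m l j => by linarith [hl m m l j]
  simp only [Fin.sum_univ_three, hr0, hl0, hr _ _ 0 1, hr _ _ 0 2, hr _ _ 1 2, hl 0 1, hl 0 2,
    hl 1 2, hsymm 1 0, hsymm 2 0, hsymm 2 1, hp 0 1 0 2, hp 0 1 1 2, hp 0 2 1 2]
  ring

end

/-! ### The model metric -/

/-- The component of `v` along the outward normal `(cos θ cos φ, sin θ cos φ, sin φ)` of the unit
sphere. -/
noncomputable def radial (v : Fin 3 → ℝ) (θ φ : ℝ) : ℝ :=
  v 0 * (Real.cos θ * Real.cos φ) + v 1 * (Real.sin θ * Real.cos φ) + v 2 * Real.sin φ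

/-- The component of `v` along the unit tangent vector `(-sin θ, cos θ, 0)` of the parallels. -/
noncomputable def east (v : Fin 3 → ℝ) (θ : ℝ) : ℝ :=
  v 1 * Real.cos θ - v 0 * Real.sin θ

/-- The component of `v` along the unit tangent vector `(-cos θ sin φ, -sin θ sin φ, cos φ)` of the
meridians. -/
noncomputable def north (v : Fin 3 → ℝ) (θ φ : ℝ) : ℝ :=
  v 2 * Real.cos φ - v 0 * (Real.cos θ * Real.sin φ) - v 1 * (Real.sin θ * Real.sin φ)

section
variable (v : Fin 3 → ℝ) (θ φ : ℝ)

theorem hasDerivAt_radial_θ :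
    HasDerivAt (fun r => radial v r φ) (Real.cos φ * east v θ) θ := by
  have h := (((Real.hasDerivAt_cos θ).mul_const (Real.cos φ)).const_mul (v 0)).add
    (((Real.hasDerivAt_sin θ).mul_const (Real.cos φ)).const_mul (v 1))
  exact (h.add_const (v 2 * Real.sin φ)).congr_deriv (by simp only [east]; ring)

theorem hasDerivAt_radial_φ : HasDerivAt (fun r => radial v θ r) (north v θ φ) φ := by
  have h := ((((Real.hasDerivAt_cos φ).const_mul (Real.cos θ)).const_mul (v 0)).add
    (((Real.hasDerivAt_cos φ).const_mul (Real.sin θ)).const_mul (v 1))).add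
    ((Real.hasDerivAt_sin φ).const_mul (v 2))
  exact h.congr_deriv (by simp only [north]; ring)

theorem hasDerivAt_east : HasDerivAt (fun r => east v r)
    (Real.sin φ * north v θ φ - Real.cos φ * radial v θ φ) θ := by
  have h := ((Real.hasDerivAt_cos θ).const_mul (v 1)).sub
    ((Real.hasDerivAt_sin θ).const_mul (v 0))
  refine h.congr_deriv ?_
  simp only [north, radial]
  linear_combination (v 0 * Real.cos θ + v 1 * Real.sin θ) * Real.sin_sq_add_cos_sq φ

theorem hasDerivAt_north_θ :
    HasDerivAt (fun r => north v r φ) (-(Real.sin φ * east v θ)) θ := by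
  have h := ((((Real.hasDerivAt_cos θ).mul_const (Real.sin φ)).const_mul (v 0)).const_sub
    (v 2 * Real.cos φ)).sub (((Real.hasDerivAt_sin θ).mul_const (Real.sin φ)).const_mul (v 1))
  exact h.congr_deriv (by simp only [east]; ring)

theorem hasDerivAt_north_φ : HasDerivAt (fun r => north v θ r) (-radial v θ φ) φ := by
  have h := (((Real.hasDerivAt_cos φ).const_mul (v 2)).sub
    (((Real.hasDerivAt_sin φ).const_mul (Real.cos θ)).const_mul (v 0))).sub
    (((Real.hasDerivAt_sin φ).const_mul (Real.sin θ)).const_mul (v 1))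
  exact h.congr_deriv (by simp only [radial]; ring)

end

section
variable (E N s : ℝ) (v w : Fin 3 → ℝ)

/-- The metric `(E + 2 v · x) dt² + 2 dt (w × x + t v) · dx + (1 + 2 s t + N t²) dx · dx` on the
product of the time axis with the unit sphere, in the coordinates `p = (t, θ, φ)`. -/
noncomputable def modelMetric (p : Fin 3 → ℝ) : Matrix (Fin 3) (Fin 3) ℝ :=
  !![E + 2 * radial v (p 1) (p 2),
      Real.cos (p 2) * (north w (p 1) (p 2) + p 0 * east v (p 1)),
      p 0 * north v (p 1) (p 2) - east w (p 1);
    Real.cos (p 2) * (north w (p 1) (p 2) + p 0 * east v (p 1)),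
      (1 + 2 * s * p 0 + N * p 0 ^ 2) * Real.cos (p 2) ^ 2, 0;
    p 0 * north v (p 1) (p 2) - east w (p 1), 0, 1 + 2 * s * p 0 + N * p 0 ^ 2]

/-- The derivative of the entry `(i, j)` of the model metric in the `k`-th coordinate. -/
noncomputable def modelDeriv (k i j : Fin 3) (p : Fin 3 → ℝ) : ℝ :=
  ![!![0, Real.cos (p 2) * east v (p 1), north v (p 1) (p 2);
      Real.cos (p 2) * east v (p 1), (2 * s + 2 * N * p 0) * Real.cos (p 2) ^ 2, 0;
      north v (p 1) (p 2), 0, 2 * s + 2 * N * p 0],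
    !![2 * (Real.cos (p 2) * east v (p 1)),
      Real.cos (p 2) * (-(Real.sin (p 2) * east w (p 1))
        + p 0 * (Real.sin (p 2) * north v (p 1) (p 2) - Real.cos (p 2) * radial v (p 1) (p 2))),
      -(p 0 * (Real.sin (p 2) * east v (p 1)))
        - (Real.sin (p 2) * north w (p 1) (p 2) - Real.cos (p 2) * radial w (p 1) (p 2));
      Real.cos (p 2) * (-(Real.sin (p 2) * east w (p 1))
        + p 0 * (Real.sin (p 2) * north v (p 1) (p 2) - Real.cos (p 2) * radial v (p 1) (p 2))),
      0, 0;
      -(p 0 * (Real.sin (p 2) * east v (p 1)))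
        - (Real.sin (p 2) * north w (p 1) (p 2) - Real.cos (p 2) * radial w (p 1) (p 2)),
      0, 0],
    !![2 * north v (p 1) (p 2),
      -(Real.sin (p 2) * (north w (p 1) (p 2) + p 0 * east v (p 1)))
        - Real.cos (p 2) * radial w (p 1) (p 2),
      -(p 0 * radial v (p 1) (p 2));
      -(Real.sin (p 2) * (north w (p 1) (p 2) + p 0 * east v (p 1)))
        - Real.cos (p 2) * radial w (p 1) (p 2),
      -(2 * (1 + 2 * s * p 0 + N * p 0 ^ 2) * (Real.cos (p 2) * Real.sin (p 2))), 0;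
      -(p 0 * radial v (p 1) (p 2)), 0, 0]] k i j

/-- The second derivative of the entry `(i, j)` of the model metric in the coordinates `k` and `l`,
at the point `(0, θ, φ)`. -/
noncomputable def modelDeriv₂ (θ φ : ℝ) (l k i j : Fin 3) : ℝ :=
  let S00 : Matrix (Fin 3) (Fin 3) ℝ := !![0, 0, 0; 0, 2 * N * Real.cos φ ^ 2, 0; 0, 0, 2 * N]
  let S01 : Matrix (Fin 3) (Fin 3) ℝ :=
    !![0, Real.cos φ * (Real.sin φ * north v θ φ - Real.cos φ * radial v θ φ),
        -(Real.sin φ * east v θ);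
      Real.cos φ * (Real.sin φ * north v θ φ - Real.cos φ * radial v θ φ), 0, 0;
      -(Real.sin φ * east v θ), 0, 0]
  let S02 : Matrix (Fin 3) (Fin 3) ℝ :=
    !![0, -(Real.sin φ * east v θ), -radial v θ φ;
      -(Real.sin φ * east v θ), -(4 * s * (Real.cos φ * Real.sin φ)), 0;
      -radial v θ φ, 0, 0]
  let S11 : Matrix (Fin 3) (Fin 3) ℝ :=
    !![2 * (Real.cos φ * (Real.sin φ * north v θ φ - Real.cos φ * radial v θ φ)),
        Real.cos φ * (Real.sin φ * (Real.cos φ * radial w θ φ - Real.sin φ * north w θ φ)),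
        east w θ;
      Real.cos φ * (Real.sin φ * (Real.cos φ * radial w θ φ - Real.sin φ * north w θ φ)), 0, 0;
      east w θ, 0, 0]
  let S12 : Matrix (Fin 3) (Fin 3) ℝ :=
    !![-(2 * (Real.sin φ * east v θ)), (Real.sin φ ^ 2 - Real.cos φ ^ 2) * east w θ, 0;
      (Real.sin φ ^ 2 - Real.cos φ ^ 2) * east w θ, 0, 0;
      0, 0, 0]
  let S22 : Matrix (Fin 3) (Fin 3) ℝ :=
    !![-(2 * radial v θ φ), 2 * (Real.sin φ * radial w θ φ - Real.cos φ * north w θ φ), 0;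
      2 * (Real.sin φ * radial w θ φ - Real.cos φ * north w θ φ),
        -(2 * (Real.cos φ ^ 2 - Real.sin φ ^ 2)), 0;
      0, 0, 0]
  ![![S00, S01, S02], ![S01, S11, S12], ![S02, S12, S22]] l k i j

theorem modelDeriv_symm (k i j : Fin 3) (p : Fin 3 → ℝ) :
    modelDeriv N s v w k i j p = modelDeriv N s v w k j i p := by
  fin_cases k <;> fin_cases i <;> fin_cases j <;> rfl

theorem modelDeriv₂_symm (θ φ : ℝ) (l k i j : Fin 3) :
    modelDeriv₂ N s v w θ φ l k i j = modelDeriv₂ N s v w θ φ k l i j := by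
  fin_cases l <;> fin_cases k <;> rfl

theorem modelDeriv₂_symm' (θ φ : ℝ) (l k i j : Fin 3) :
    modelDeriv₂ N s v w θ φ l k i j = modelDeriv₂ N s v w θ φ l k j i := by
  fin_cases l <;> fin_cases k <;> fin_cases i <;> fin_cases j <;> rfl

theorem modelMetric_symm (i j : Fin 3) (p : Fin 3 → ℝ) :
    modelMetric E N s v w p i j = modelMetric E N s v w p j i := by
  fin_cases i <;> fin_cases j <;> rfl

theorem forall_fin_three_symm {P : Fin 3 → Fin 3 → Prop} (h : ∀ i j, P i j → P j i)
    (h00 : P 0 0) (h01 : P 0 1) (h02 : P 0 2) (h11 : P 1 1) (h12 : P 1 2) (h22 : P 2 2)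
    (i j : Fin 3) : P i j := by
  fin_cases i <;> fin_cases j <;> first | assumption | (apply h; assumption)

theorem hasDerivAt_modelMetric (k i j : Fin 3) (p : Fin 3 → ℝ) :
    HasDerivAt (fun r => modelMetric E N s v w (Function.update p k r) i j)
      (modelDeriv N s v w k i j p) (p k) := by
  have ht : HasDerivAt (fun r => 1 + 2 * s * r + N * r ^ 2) (2 * s + 2 * N * p 0) (p 0) :=
    ((((hasDerivAt_id (p 0)).const_mul (2 * s)).const_add 1).add
      (((hasDerivAt_id (p 0)).pow 2).const_mul N)).congr_deriv (by simp; ring)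
  have hcos := Real.hasDerivAt_cos (p 2)
  revert i j
  refine forall_fin_three_symm (fun i j h => ?_) ?_ ?_ ?_ ?_ ?_ ?_
  · simpa only [modelMetric_symm E N s v w j i, modelDeriv_symm N s v w k j i] using h
  all_goals
    fin_cases k <;> simp [modelMetric, modelDeriv, hasDerivAt_const]
  · exact (hasDerivAt_radial_θ v _ _).const_mul 2
  · exact (hasDerivAt_radial_φ v _ _).const_mul 2
  · simpa using (((hasDerivAt_id (p 0)).mul_const (east v (p 1))).const_add
      (north w (p 1) (p 2))).const_mul (Real.cos (p 2))
  · exact ((hasDerivAt_north_θ w _ _).add ((hasDerivAt_east v _ _).const_mul _)).const_mul _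
  · exact (hcos.mul ((hasDerivAt_north_φ w _ _).add_const _)).congr_deriv (by ring)
  · simpa using (hasDerivAt_id (p 0)).mul_const (north v (p 1) (p 2))
  · exact (((hasDerivAt_north_θ v _ _).const_mul _).sub (hasDerivAt_east w _ (p 2))).congr_deriv
      (by ring)
  · exact ((hasDerivAt_north_φ v _ _).const_mul _).congr_deriv (by ring)
  · exact ht.mul_const _
  · exact ((hcos.pow 2).const_mul _).congr_deriv (by ring)
  · exact ht

theorem hasDerivAt_modelDeriv (l k i j : Fin 3) (p : Fin 3 → ℝ) (hp : p 0 = 0) :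
    HasDerivAt (fun r => modelDeriv N s v w k i j (Function.update p l r))
      (modelDeriv₂ N s v w (p 1) (p 2) l k i j) (p l) := by
  have ht : HasDerivAt (fun r => 2 * s + 2 * N * r) (2 * N) (p 0) :=
    (((hasDerivAt_id (p 0)).const_mul (2 * N)).const_add (2 * s)).congr_deriv (by simp)
  have ht' : HasDerivAt (fun r => 1 + 2 * s * r + N * r ^ 2) (2 * s) (p 0) :=
    ((((hasDerivAt_id (p 0)).const_mul (2 * s)).const_add 1).add
      (((hasDerivAt_id (p 0)).pow 2).const_mul N)).congr_deriv (by simp [hp])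
  have hid := fun c : ℝ => (hasDerivAt_id (p 0)).mul_const c
  have hcos := Real.hasDerivAt_cos (p 2)
  have hsin := Real.hasDerivAt_sin (p 2)
  have hcs := Real.sin_sq_add_cos_sq (p 2)
  have heast := fun v => hasDerivAt_east v (p 1) (p 2)
  have hnθ := fun v => hasDerivAt_north_θ v (p 1) (p 2)
  have hnφ := fun v => hasDerivAt_north_φ v (p 1) (p 2)
  have hrθ := fun v => hasDerivAt_radial_θ v (p 1) (p 2)
  have hrφ := fun v => hasDerivAt_radial_φ v (p 1) (p 2)
  revert i j
  refine forall_fin_three_symm (fun i j h => ?_) ?_ ?_ ?_ ?_ ?_ ?_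
  · simpa only [modelDeriv_symm N s v w k j i, modelDeriv₂_symm' N s v w _ _ l k j i] using h
  all_goals
    fin_cases l <;> fin_cases k <;>
      simp only [modelDeriv, modelDeriv₂, Fin.isValue, Fin.zero_eta, Fin.mk_one, Fin.reduceFinMk,
        Matrix.of_apply, Matrix.cons_val, Function.update_self, Function.update_of_ne, ne_eq,
        Fin.reduceEq, not_false_eq_true, hasDerivAt_const, zero_ne_one, one_ne_zero]
  · exact ((heast v).const_mul _).const_mul _
  · exact ((hnθ v).const_mul _).congr_deriv (by ring)
  · exact ((hcos.mul_const _).const_mul _).congr_deriv (by ring)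
  · exact ((hnφ v).const_mul _).congr_deriv (by ring)
  · exact (((hid _).const_add _).const_mul _).congr_deriv (by ring)
  · exact ((((hid _).const_add _).const_mul _).neg.sub_const _).congr_deriv (by ring)
  · exact (heast v).const_mul _
  · exact ((((heast w).const_mul _).neg.add ((((hnθ v).const_mul _).sub
      ((hrθ v).const_mul _)).const_mul _)).const_mul _).congr_deriv (by rw [hp]; ring)
  · exact ((((hnθ w).add ((heast v).const_mul _)).const_mul _).neg.sub
      ((hrθ w).const_mul _)).congr_deriv (by rw [hp]; ring)
  · exact (hcos.mul_const _).congr_deriv (by ring)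
  · exact (hcos.mul ((hsin.mul_const _).neg.add (((hsin.mul (hnφ v)).sub
      (hcos.mul (hrφ v))).const_mul _))).congr_deriv (by
        simp only [hp, Pi.add_apply, Pi.neg_apply]; ring)
  · exact ((hsin.mul ((hnφ w).add_const _)).neg.sub (hcos.mul (hrφ w))).congr_deriv
      (by simp only [hp]; ring)
  · exact ((hid _).neg.sub_const _).congr_deriv (by ring)
  · exact (hid _).neg.congr_deriv (by ring)
  · exact hnθ v
  · exact ((((heast v).const_mul _).const_mul _).neg.sub (((hnθ w).const_mul _).sub
      ((hrθ w).const_mul _))).congr_deriv (by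
        rw [hp]; linear_combination east w (p 1) * hcs)
  · exact ((hrθ v).const_mul _).neg.congr_deriv (by rw [hp]; ring)
  · exact hnφ v
  · exact (((hsin.mul_const _).const_mul _).neg.sub ((hsin.mul (hnφ w)).sub
      (hcos.mul (hrφ w)))).congr_deriv (by rw [hp]; ring)
  · exact ((hrφ v).const_mul _).neg.congr_deriv (by rw [hp]; ring)
  · exact ht.mul_const _
  · exact ((ht'.const_mul 2).mul_const _).neg.congr_deriv (by ring)
  · exact ((hcos.pow 2).const_mul _).congr_deriv (by rw [hp]; ring)
  · exact ((hcos.mul hsin).const_mul _).neg.congr_deriv (by rw [hp]; ring)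
  · exact ht

end

/-! ### Scalar curvature of the model metric at time zero -/

/-- The squared lapse `E + 2 v · x - |w × x|²` of the model metric at `t = 0`: the determinant is
`cos² φ` times this quantity. -/
noncomputable def lapseSq (E : ℝ) (v w : Fin 3 → ℝ) (θ φ : ℝ) : ℝ :=
  E + 2 * radial v θ φ - east w θ ^ 2 - north w θ φ ^ 2

section
variable (E N s : ℝ) (v w : Fin 3 → ℝ) (θ φ : ℝ)

theorem modelMetric_zero : modelMetric E N s v w ![0, θ, φ] =
    !![E + 2 * radial v θ φ, Real.cos φ * north w θ φ, -east w θ;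
      Real.cos φ * north w θ φ, Real.cos φ ^ 2, 0; -east w θ, 0, 1] := by
  simp [modelMetric]

theorem det_modelMetric_zero : (modelMetric E N s v w ![0, θ, φ]).det =
    Real.cos φ ^ 2 * lapseSq E v w θ φ := by
  rw [modelMetric_zero, Matrix.det_fin_three]
  simp [lapseSq]
  ring

theorem inv_modelMetric_zero (hdet : (modelMetric E N s v w ![0, θ, φ]).det ≠ 0) :
    (modelMetric E N s v w ![0, θ, φ])⁻¹ =
      !![1 / lapseSq E v w θ φ, -(north w θ φ / (Real.cos φ * lapseSq E v w θ φ)),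
          east w θ / lapseSq E v w θ φ;
        -(north w θ φ / (Real.cos φ * lapseSq E v w θ φ)),
          (lapseSq E v w θ φ + north w θ φ ^ 2) / (Real.cos φ ^ 2 * lapseSq E v w θ φ),
          -(north w θ φ * east w θ / (Real.cos φ * lapseSq E v w θ φ));
        east w θ / lapseSq E v w θ φ,
          -(north w θ φ * east w θ / (Real.cos φ * lapseSq E v w θ φ)),
          (lapseSq E v w θ φ + east w θ ^ 2) / lapseSq E v w θ φ] := by
  rw [det_modelMetric_zero] at hdet
  have hu : lapseSq E v w θ φ ≠ 0 := right_ne_zero_of_mul hdet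
  have hc : Real.cos φ ≠ 0 := fun h => hdet (by simp [h])
  have hE : E = lapseSq E v w θ φ - 2 * radial v θ φ + east w θ ^ 2 + north w θ φ ^ 2 := by
    simp only [lapseSq]; ring
  rw [modelMetric_zero]
  generalize lapseSq E v w θ φ = u at *
  refine Matrix.inv_eq_right_inv ?_
  subst hE
  ext i j
  fin_cases i <;> fin_cases j <;>
    simp [Matrix.mul_apply, Fin.sum_univ_three] <;> field_simp <;> ring

/-- The scalar curvature of the model metric at `t = 0`, in terms of the components of `v` and `w`
in the moving frame of the sphere. -/
theorem scalarCurvature_modelMetric (hdet : (modelMetric E N s v w ![0, θ, φ]).det ≠ 0) :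
    (scalarCurvature (modelMetric E N s v w) ![0, θ, φ] - 2) * lapseSq E v w θ φ ^ 2 =
      -(4 * N - 2 * s ^ 2 - 4 * radial w θ φ ^ 2 + 2 * (east w θ ^ 2 + north w θ φ ^ 2))
          * lapseSq E v w θ φ
        + 4 * s ^ 2 * (east w θ ^ 2 + north w θ φ ^ 2)
        - 8 * s * (east v θ * north w θ φ - north v θ φ * east w θ)
        + 2 * ((east v θ + radial w θ φ * east w θ) ^ 2
          + (north v θ φ + radial w θ φ * north w θ φ) ^ 2) := by
  have hinv := inv_modelMetric_zero E N s v w θ φ hdet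
  have hD := hasDerivAt_modelMetric E N s v w
  have hS : ∀ l k i j, HasDerivAt
    (fun r => modelDeriv N s v w k i j (Function.update ![0, θ, φ] l r))
      (modelDeriv₂ N s v w θ φ l k i j) ((![0, θ, φ] : Fin 3 → ℝ) l) := fun l k i j =>
    hasDerivAt_modelDeriv N s v w l k i j ![0, θ, φ] rfl
  rw [scalarCurvature_eq_minors hD hS hdet hinv ?_ (fun _ _ _ => modelDeriv_symm N s v w _ _ _ _)
    (modelDeriv₂_symm N s v w θ φ) (modelDeriv₂_symm' N s v w θ φ)]
  swap
  · intro i j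
    fin_cases i <;> fin_cases j <;> rfl
  rw [det_modelMetric_zero] at hdet
  have hu : lapseSq E v w θ φ ≠ 0 := right_ne_zero_of_mul hdet
  have hc : Real.cos φ ≠ 0 := fun h => hdet (by simp [h])
  have hs : Real.sin φ ^ 2 = 1 - Real.cos φ ^ 2 := Real.sin_sq φ
  generalize lapseSq E v w θ φ = u at *
  simp only [lowerRiemann, christoffelLower, modelDeriv, modelDeriv₂, Fin.sum_univ_three,
    Fin.isValue, Matrix.of_apply, Matrix.cons_val, mul_zero, zero_mul, add_zero, zero_add, sub_zero,
    zero_sub, sub_self, neg_zero]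
  generalize Real.cos φ = c at *
  generalize Real.sin φ = σ at *
  generalize radial v θ φ = v0 at *
  generalize north v θ φ = v2 at *
  generalize east v θ = v1 at *
  generalize radial w θ φ = w0 at *
  generalize north w θ φ = w2 at *
  generalize east w θ = w1 at *
  clear hD hS hinv
  field_simp
  ring_nf
  simp only [hs]
  ring
end

/-! ### The first fundamental form of the kinematic surface -/

/-- The inclusion of the space of the first three coordinates into `E⁷`. -/
def embed (y : Fin 3 → ℝ) : Fin 7 → ℝ := ![y 0, y 1, y 2, 0, 0, 0, 0]

namespace EquiformMotion

variable (M : EquiformMotion)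

theorem hasDerivAt_A (i j : Fin 7) : HasDerivAt (fun t => M.A t i j) (M.Ω i j) 0 :=
  (((M.contDiff_A i j).differentiableOn (by norm_num)).differentiableAt
    (M.isOpen_I.mem_nhds M.zero_mem)).hasDerivAt

/-- `Ω` is skew-symmetric: differentiate `A Aᵀ = I` at `t = 0`. -/
theorem Ω_skew (i j : Fin 7) : M.Ω j i = -M.Ω i j := by
  have h1 : HasDerivAt (fun t => (M.A t * (M.A t)ᵀ) i j) (M.Ω i j + M.Ω j i) 0 := by
    have h : HasDerivAt (fun t => (M.A t * (M.A t)ᵀ) i j)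
        (∑ k, (M.Ω i k * M.A 0 j k + M.A 0 i k * M.Ω j k)) 0 := by
      simp only [Matrix.mul_apply, Matrix.transpose_apply]
      exact HasDerivAt.fun_sum fun k _ => (M.hasDerivAt_A i k).mul (M.hasDerivAt_A j k)
    simpa [M.A_zero, Matrix.one_apply, Finset.sum_add_distrib] using h
  have h2 : (fun t => (M.A t * (M.A t)ᵀ) i j) =ᶠ[nhds 0]
      fun _ => (1 : Matrix (Fin 7) (Fin 7) ℝ) i j := by
    filter_upwards [M.isOpen_I.mem_nhds M.zero_mem] with t ht
    have h := (Matrix.mem_specialOrthogonalGroup_iff.mp (M.A_mem t ht)).1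
    rw [(Matrix.mem_orthogonalGroup_iff (Fin 7) ℝ).mp h]
  linarith [h1.unique ((hasDerivAt_const (0 : ℝ) _).congr_of_eventuallyEq h2)]

/-- The axial vector of the restriction of `Ω` to the space of the first three coordinates. -/
noncomputable def axial : Fin 3 → ℝ := ![-M.ω 7, M.ω 2, -M.ω 1]

/-- The vector with components `Ω eᵢ · d'` for `i = 1, 2, 3`, under the assumption
`b'₁ = b'₂ = b'₃ = 0`. -/
noncomputable def drift : Fin 3 → ℝ :=
  ![-∑ i ∈ Finset.Icc 4 7, M.b' i * M.ω (i - 1), -∑ i ∈ Finset.Icc 4 7, M.b' i * M.ω (i + 4),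
    -∑ i ∈ Finset.Icc 4 7, M.b' i * M.ω (i + 8)]

/-- The squared length of `Ω e₁`; on a surface foliated by spheres it is also that of `Ω e₂` and
`Ω e₃`. -/
noncomputable def dilation : ℝ := M.ω 1 ^ 2 + ∑ i ∈ Finset.Icc 2 6, M.ω i ^ 2

/-- The squared length of `d'`, under the assumption `b'₁ = b'₂ = b'₃ = 0`. -/
noncomputable def speedSq : ℝ := ∑ i ∈ Finset.Icc 4 7, M.b' i ^ 2

theorem embed_dotProduct (y z : Fin 3 → ℝ) : embed y ⬝ᵥ embed z = y ⬝ᵥ z := by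
  simp [embed, dotProduct, Fin.sum_univ_succ]

theorem embed_dotProduct_Ω (y z : Fin 3 → ℝ) :
    embed y ⬝ᵥ (M.Ω *ᵥ embed z) = y ⬝ᵥ crossProduct M.axial z := by
  have hd : ∀ i, M.Ω i i = 0 := fun i => by linarith [M.Ω_skew i i]
  simp [embed, dotProduct, Matrix.mulVec, Fin.sum_univ_succ, cross_apply, axial, ω, hd,
    M.Ω_skew 0 1, M.Ω_skew 0 2, M.Ω_skew 1 2]
  ring

/-- The conditions for a foliation by spheres say that `Ω` restricted to the space of the first
three coordinates is a similarity onto its image. -/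
theorem Ω_dotProduct_Ω (hM : M.FoliatedBySpheres) (y z : Fin 3 → ℝ) :
    (M.Ω *ᵥ embed y) ⬝ᵥ (M.Ω *ᵥ embed z) = M.dilation * (y ⬝ᵥ z) := by
  obtain ⟨h01, h02, h12, n01, n02⟩ := hM
  simp only [show Finset.Icc 2 6 = {2, 3, 4, 5, 6} from rfl,
    show Finset.Icc 3 6 = {3, 4, 5, 6} from rfl, show Finset.Icc 7 11 = {7, 8, 9, 10, 11} from rfl,
    show Finset.Icc 8 11 = {8, 9, 10, 11} from rfl,
    show Finset.Icc 12 15 = {12, 13, 14, 15} from rfl] at h01 h02 h12 n01 n02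
  simp [ω] at h01 h02 h12 n01 n02
  have hd : ∀ i, M.Ω i i = 0 := fun i => by linarith [M.Ω_skew i i]
  simp [embed, dotProduct, Matrix.mulVec, Fin.sum_univ_succ, dilation, ω, hd,
    M.Ω_skew 0, M.Ω_skew 1 2, M.Ω_skew 1 3, M.Ω_skew 1 4, M.Ω_skew 1 5, M.Ω_skew 1 6,
    M.Ω_skew 2 3, M.Ω_skew 2 4, M.Ω_skew 2 5, M.Ω_skew 2 6,
    show Finset.Icc 2 6 = {2, 3, 4, 5, 6} from rfl]
  linear_combination (y 0 * z 1 + y 1 * z 0) * h01 - (y 0 * z 2 + y 2 * z 0) * h02 +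
    (y 1 * z 2 + y 2 * z 1) * h12 - (y 1 * z 1) * n01 - y 2 * z 2 * n02

theorem Ω_dotProduct_d' (hb : M.b' 1 = 0 ∧ M.b' 2 = 0 ∧ M.b' 3 = 0) (y : Fin 3 → ℝ) :
    (M.Ω *ᵥ embed y) ⬝ᵥ M.d' = M.drift ⬝ᵥ y := by
  have hd : ∀ i, M.Ω i i = 0 := fun i => by linarith [M.Ω_skew i i]
  simp only [b'] at hb
  simp [embed, dotProduct, Matrix.mulVec, Fin.sum_univ_succ, drift, ω, b', hb, hd,
    M.Ω_skew 0, M.Ω_skew 1 2, M.Ω_skew 1 3, M.Ω_skew 1 4, M.Ω_skew 1 5, M.Ω_skew 1 6,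
    M.Ω_skew 2 3, M.Ω_skew 2 4, M.Ω_skew 2 5, M.Ω_skew 2 6,
    show Finset.Icc 4 7 = {4, 5, 6, 7} from rfl]
  ring

theorem embed_dotProduct_d' (hb : M.b' 1 = 0 ∧ M.b' 2 = 0 ∧ M.b' 3 = 0) (y : Fin 3 → ℝ) :
    embed y ⬝ᵥ M.d' = 0 := by
  simp only [b'] at hb
  simp [embed, dotProduct, Fin.sum_univ_succ, hb]

theorem d'_dotProduct_d' (hb : M.b' 1 = 0 ∧ M.b' 2 = 0 ∧ M.b' 3 = 0) :
    M.d' ⬝ᵥ M.d' = M.speedSq := by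
  simp only [b'] at hb
  simp [dotProduct, Fin.sum_univ_succ, hb, speedSq, b',
    show Finset.Icc 4 7 = {4, 5, 6, 7} from rfl, pow_two]

theorem sphere_eq_embed (θ φ : ℝ) : sphere θ φ =
    embed ![Real.cos θ * Real.cos φ, Real.sin θ * Real.cos φ, Real.sin φ] := by
  simp [sphere, embed]

theorem hasDerivAt_embed {f : ℝ → Fin 3 → ℝ} {f' : Fin 3 → ℝ} {r : ℝ}
    (h : ∀ i, HasDerivAt (fun r => f r i) (f' i) r) :
    HasDerivAt (fun r => embed (f r)) (embed f') r := by
  rw [hasDerivAt_pi]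
  intro i
  fin_cases i
  · exact h 0
  · exact h 1
  · exact h 2
  all_goals exact hasDerivAt_const r (0 : ℝ)

theorem hasDerivAt_mulVec {m n : Type*} [Fintype n] [Fintype m] (A : Matrix m n ℝ)
    {f : ℝ → n → ℝ} {f' : n → ℝ} {r : ℝ} (h : HasDerivAt f f' r) :
    HasDerivAt (fun r => A *ᵥ f r) (A *ᵥ f') r :=
  hasDerivAt_pi.2 fun _ => HasDerivAt.fun_sum fun j _ => (hasDerivAt_pi.1 h j).const_mul _

theorem pd_surface_zero (p : Fin 3 → ℝ) : pd 0 M.surface p =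
    M.s' • sphere (p 1) (p 2) + M.Ω *ᵥ sphere (p 1) (p 2) + M.d' := by
  have h : HasDerivAt (fun r : ℝ => sphere (p 1) (p 2)
      + r • (M.s' • sphere (p 1) (p 2) + M.Ω *ᵥ sphere (p 1) (p 2) + M.d'))
      (M.s' • sphere (p 1) (p 2) + M.Ω *ᵥ sphere (p 1) (p 2) + M.d') (p 0) := by
    simpa using ((hasDerivAt_id (p 0)).smul_const
      (M.s' • sphere (p 1) (p 2) + M.Ω *ᵥ sphere (p 1) (p 2) + M.d')).const_add
        (sphere (p 1) (p 2))
  refine Eq.trans ?_ h.deriv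
  simp only [pd, surface, Function.update_self, Function.update_of_ne, ne_eq, Fin.reduceEq,
    one_ne_zero, not_false_eq_true]
  congr 1
  funext r
  simp only [Matrix.add_mulVec, Matrix.smul_mulVec, Matrix.one_mulVec, smul_add, add_assoc]

theorem pd_surface_one (p : Fin 3 → ℝ) : pd 1 M.surface p =
    (1 + p 0 • (M.s' • (1 : Matrix (Fin 7) (Fin 7) ℝ) + M.Ω)) *ᵥ
      embed ![-Real.sin (p 1) * Real.cos (p 2), Real.cos (p 1) * Real.cos (p 2), 0] := by
  refine HasDerivAt.deriv ?_
  simp only [surface, Function.update_self, Function.update_of_ne, ne_eq, Fin.reduceEq,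
    zero_ne_one, not_false_eq_true, sphere_eq_embed]
  refine (hasDerivAt_mulVec _ (hasDerivAt_embed ?_)).add_const _
  intro i
  fin_cases i
  · exact (Real.hasDerivAt_cos _).mul_const _
  · exact (Real.hasDerivAt_sin _).mul_const _
  · exact hasDerivAt_const _ _

theorem pd_surface_two (p : Fin 3 → ℝ) : pd 2 M.surface p =
    (1 + p 0 • (M.s' • (1 : Matrix (Fin 7) (Fin 7) ℝ) + M.Ω)) *ᵥ
      embed ![Real.cos (p 1) * -Real.sin (p 2), Real.sin (p 1) * -Real.sin (p 2),
        Real.cos (p 2)] := by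
  refine HasDerivAt.deriv ?_
  simp only [surface, Function.update_self, Function.update_of_ne, ne_eq, Fin.reduceEq,
    not_false_eq_true, sphere_eq_embed]
  refine (hasDerivAt_mulVec _ (hasDerivAt_embed ?_)).add_const _
  intro i
  fin_cases i
  · exact (Real.hasDerivAt_cos _).const_mul _
  · exact (Real.hasDerivAt_cos _).const_mul _
  · exact Real.hasDerivAt_sin _

theorem firstForm_surface (hM : M.FoliatedBySpheres)
    (hb : M.b' 1 = 0 ∧ M.b' 2 = 0 ∧ M.b' 3 = 0) :
    firstForm M.surface = modelMetric (M.s' ^ 2 + M.dilation + M.speedSq)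
      (M.s' ^ 2 + M.dilation) M.s' M.drift M.axial := by
  funext p
  have hs1 := Real.sin_sq (p 1)
  have hs2 := Real.sin_sq (p 2)
  have hΩe : ∀ y z, (M.Ω *ᵥ embed y) ⬝ᵥ embed z = z ⬝ᵥ crossProduct M.axial y := fun y z => by
    rw [dotProduct_comm, embed_dotProduct_Ω]
  have hdΩ : ∀ y, M.d' ⬝ᵥ (M.Ω *ᵥ embed y) = M.drift ⬝ᵥ y := fun y => by
    rw [dotProduct_comm, M.Ω_dotProduct_d' hb]
  have hde : ∀ y, M.d' ⬝ᵥ embed y = 0 := fun y => by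
    rw [dotProduct_comm, M.embed_dotProduct_d' hb]
  have key : ∀ i j, pd i M.surface p ⬝ᵥ pd j M.surface p = modelMetric
      (M.s' ^ 2 + M.dilation + M.speedSq) (M.s' ^ 2 + M.dilation) M.s' M.drift M.axial p i j := by
    refine forall_fin_three_symm (fun i j h => ?_) ?_ ?_ ?_ ?_ ?_ ?_
    · rw [dotProduct_comm, h, modelMetric_symm]
    all_goals
      simp only [pd_surface_zero, pd_surface_one, pd_surface_two, sphere_eq_embed,
        Matrix.add_mulVec, Matrix.smul_mulVec, Matrix.one_mulVec, dotProduct_add, add_dotProduct,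
        dotProduct_smul, smul_dotProduct, embed_dotProduct, embed_dotProduct_Ω, hΩe, hdΩ, hde,
        M.Ω_dotProduct_Ω hM, M.Ω_dotProduct_d' hb, M.embed_dotProduct_d' hb,
        M.d'_dotProduct_d' hb, smul_eq_mul]
      simp only [modelMetric, Matrix.of_apply, Matrix.cons_val, dotProduct, Fin.sum_univ_three,
        cross_apply, radial, north, east]
      ring_nf <;> simp only [hs1, hs2] <;> ring
  ext i j
  exact key i j

end EquiformMotion

/-! ### The curvature equation on the whole sphere -/

theorem radial_mul_add_east_mul_add_north_mul (v w : Fin 3 → ℝ) (θ φ : ℝ) :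
    radial v θ φ * radial w θ φ + east v θ * east w θ + north v θ φ * north w θ φ = v ⬝ᵥ w := by
  simp only [radial, east, north, dotProduct, Fin.sum_univ_three]
  have hs1 := Real.sin_sq θ
  have hs2 := Real.sin_sq φ
  ring_nf
  simp only [hs1, hs2]
  ring

theorem east_mul_north_sub_north_mul_east (v w : Fin 3 → ℝ) (θ φ : ℝ) :
    east v θ * north w θ φ - north v θ φ * east w θ = v ⬝ᵥ crossProduct w
      ![Real.cos θ * Real.cos φ, Real.sin θ * Real.cos φ, Real.sin φ] := by
  simp only [east, north, dotProduct, Fin.sum_univ_three, cross_apply, Matrix.cons_val]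
  have hs1 := Real.sin_sq θ
  ring_nf
  simp only [hs1]
  ring

theorem radial_eq_dotProduct (v : Fin 3 → ℝ) (θ φ : ℝ) : radial v θ φ =
    v ⬝ᵥ ![Real.cos θ * Real.cos φ, Real.sin θ * Real.cos φ, Real.sin φ] := by
  simp [radial, dotProduct, Fin.sum_univ_three]

theorem exists_spherical_coordinates {x : Fin 3 → ℝ} (hx : x ⬝ᵥ x = 1) :
    ∃ θ φ, ![Real.cos θ * Real.cos φ, Real.sin θ * Real.cos φ, Real.sin φ] = x := by
  simp only [dotProduct, Fin.sum_univ_three] at hx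
  have h0 : 1 - x 2 ^ 2 = x 0 ^ 2 + x 1 ^ 2 := by linarith
  have h2 : x 2 ^ 2 ≤ 1 := by nlinarith [sq_nonneg (x 0), sq_nonneg (x 1)]
  have h3 := abs_le.mp ((sq_le_one_iff_abs_le_one _).mp h2)
  set ζ : ℂ := ⟨x 0, x 1⟩
  have hnorm : Real.cos (Real.arcsin (x 2)) = ‖ζ‖ := by
    rw [Real.cos_arcsin, h0, Complex.norm_eq_sqrt_sq_add_sq]
  refine ⟨ζ.arg, Real.arcsin (x 2), ?_⟩
  rw [hnorm, Real.sin_arcsin h3.1 h3.2, mul_comm, Complex.norm_mul_cos_arg, mul_comm,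
    Complex.norm_mul_sin_arg]
  ext i
  fin_cases i <;> rfl

/-- The polynomial equation in a point `x` of the unit sphere which says that the scalar curvature
of the model metric at `(0, x)` is `K`, cleared of its denominator, the square of
`E + 2 v · x - |w × x|² = E + 2 v · x - |w|² + (w · x)²`. -/
def CurvatureEquation (K E N s : ℝ) (v w x : Fin 3 → ℝ) : Prop :=
  (K - 2) * (E + 2 * (v ⬝ᵥ x) - w ⬝ᵥ w + (w ⬝ᵥ x) ^ 2) ^ 2 =
    -(4 * N - 2 * s ^ 2 + 2 * (w ⬝ᵥ w) - 6 * (w ⬝ᵥ x) ^ 2)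
        * (E + 2 * (v ⬝ᵥ x) - w ⬝ᵥ w + (w ⬝ᵥ x) ^ 2)
      + 4 * s ^ 2 * (w ⬝ᵥ w - (w ⬝ᵥ x) ^ 2) - 8 * s * (v ⬝ᵥ crossProduct w x)
      + 2 * (v ⬝ᵥ v + 2 * (w ⬝ᵥ x) * (v ⬝ᵥ w) + (w ⬝ᵥ x) ^ 2 * (w ⬝ᵥ w)
        - (v ⬝ᵥ x + (w ⬝ᵥ x) ^ 2) ^ 2)

/-- The curvature equation holds near a regular point, hence on the whole sphere, because it is
analytic in `(θ, φ)`. -/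
theorem curvatureEquation_of_regular {K E N s : ℝ} {v w : Fin 3 → ℝ}
    (hreg : ∃ θ φ, (modelMetric E N s v w ![0, θ, φ]).det ≠ 0)
    (hK : ∀ θ φ, (modelMetric E N s v w ![0, θ, φ]).det ≠ 0 →
      scalarCurvature (modelMetric E N s v w) ![0, θ, φ] = K)
    (x : Fin 3 → ℝ) (hx : x ⬝ᵥ x = 1) : CurvatureEquation K E N s v w x := by
  let F : ℝ × ℝ → ℝ := fun q => (K - 2) * lapseSq E v w q.1 q.2 ^ 2 -
      (-(4 * N - 2 * s ^ 2 - 4 * radial w q.1 q.2 ^ 2 + 2 * (east w q.1 ^ 2 + north w q.1 q.2 ^ 2))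
          * lapseSq E v w q.1 q.2
        + 4 * s ^ 2 * (east w q.1 ^ 2 + north w q.1 q.2 ^ 2)
        - 8 * s * (east v q.1 * north w q.1 q.2 - north v q.1 q.2 * east w q.1)
        + 2 * ((east v q.1 + radial w q.1 q.2 * east w q.1) ^ 2
          + (north v q.1 q.2 + radial w q.1 q.2 * north w q.1 q.2) ^ 2))
  have hF : AnalyticOnNhd ℝ F Set.univ := by
    rw [← contDiff_omega_iff_analyticOnNhd]
    simp only [F, lapseSq, radial, east, north]
    fun_prop
  obtain ⟨θ₀, φ₀, h₀⟩ := hreg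
  have hev : ∀ᶠ q : ℝ × ℝ in nhds (θ₀, φ₀), F q = 0 := by
    have hc : Continuous fun q : ℝ × ℝ => (modelMetric E N s v w ![0, q.1, q.2]).det := by
      simp only [det_modelMetric_zero, lapseSq, radial, east, north]
      fun_prop
    filter_upwards [hc.continuousAt.eventually_ne h₀] with q hq
    have h := scalarCurvature_modelMetric E N s v w q.1 q.2 hq
    rw [hK q.1 q.2 hq] at h
    exact sub_eq_zero.mpr h
  have hzero : ∀ q, F q = 0 := fun q =>
    hF.eqOn_zero_of_preconnected_of_eventuallyEq_zero isPreconnected_univ (Set.mem_univ _) hev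
      (Set.mem_univ q)
  obtain ⟨θ, φ, rfl⟩ := exists_spherical_coordinates hx
  have h := hzero (θ, φ)
  simp only [F, lapseSq] at h
  have h1 := radial_mul_add_east_mul_add_north_mul v v θ φ
  have h2 := radial_mul_add_east_mul_add_north_mul v w θ φ
  have h3 := radial_mul_add_east_mul_add_north_mul w w θ φ
  simp only [CurvatureEquation, ← radial_eq_dotProduct, ← east_mul_north_sub_north_mul_east, ← h1,
    ← h2, ← h3]
  linear_combination h

/-! ### Consequences of the curvature equation -/

theorem exists_unit_orthogonal (v w : Fin 3 → ℝ) :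
    ∃ g : Fin 3 → ℝ, g ⬝ᵥ g = 1 ∧ v ⬝ᵥ g = 0 ∧ w ⬝ᵥ g = 0 := by
  obtain ⟨g, hg, h⟩ := (Matrix.exists_mulVec_eq_zero_iff (M := Matrix.of ![v, w, 0])).mpr
    (by simp [Matrix.det_fin_three])
  have hv : v ⬝ᵥ g = 0 := congrFun h 0
  have hw : w ⬝ᵥ g = 0 := congrFun h 1
  have hpos : 0 < g ⬝ᵥ g := by
    simpa using (Matrix.dotProduct_star_self_pos_iff (v := g)).mpr hg
  refine ⟨(√(g ⬝ᵥ g))⁻¹ • g, ?_, by simp [hv], by simp [hw]⟩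
  have := Real.sq_sqrt hpos.le
  have h0 := (Real.sqrt_pos.mpr hpos).ne'
  simp only [smul_dotProduct, dotProduct_smul, smul_eq_mul]
  field_simp
  linarith

/-- A quartic polynomial which vanishes on `[-1, 1]` is zero. -/
theorem quartic_coeff_eq_zero {c₀ c₁ c₂ c₃ c₄ : ℝ}
    (h : ∀ C S : ℝ, C ^ 2 + S ^ 2 = 1 →
      c₀ + c₁ * C + c₂ * C ^ 2 + c₃ * C ^ 3 + c₄ * C ^ 4 = 0) :
    c₀ = 0 ∧ c₁ = 0 ∧ c₂ = 0 ∧ c₃ = 0 ∧ c₄ = 0 := by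
  have h0 := h 0 1 (by norm_num)
  have h1 := h 1 0 (by norm_num)
  have h2 := h (-1) 0 (by norm_num)
  have h3 := h (3 / 5) (4 / 5) (by norm_num)
  have h4 := h (-(3 / 5)) (4 / 5) (by norm_num)
  norm_num at h0 h1 h2 h3 h4
  refine ⟨?_, ?_, ?_, ?_, ?_⟩ <;> linarith

/-- The curvature equation on the great circle of the points `x = C e + S g`, where `e` is parallel
to `w`, and `g` is orthogonal to `v`, `w` and `e`: the only term odd in `S`, the triple product of
`v`, `w` and `x`, is removed by averaging over `S` and `-S`. -/
theorem curvatureEquation_greatCircle {K E N s : ℝ} {v w e g : Fin 3 → ℝ}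
    (h : ∀ x, x ⬝ᵥ x = 1 → CurvatureEquation K E N s v w x)
    (he : e ⬝ᵥ e = 1) (hg : g ⬝ᵥ g = 1) (heg : e ⬝ᵥ g = 0) (hvg : v ⬝ᵥ g = 0)
    (hwg : w ⬝ᵥ g = 0) (hwe : crossProduct w e = 0) {C S : ℝ} (hCS : C ^ 2 + S ^ 2 = 1) :
    (K - 2) * (E + 2 * ((v ⬝ᵥ e) * C) - w ⬝ᵥ w + ((w ⬝ᵥ e) * C) ^ 2) ^ 2 =
      -(4 * N - 2 * s ^ 2 + 2 * (w ⬝ᵥ w) - 6 * ((w ⬝ᵥ e) * C) ^ 2)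
          * (E + 2 * ((v ⬝ᵥ e) * C) - w ⬝ᵥ w + ((w ⬝ᵥ e) * C) ^ 2)
        + 4 * s ^ 2 * (w ⬝ᵥ w - ((w ⬝ᵥ e) * C) ^ 2)
        + 2 * (v ⬝ᵥ v + 2 * ((w ⬝ᵥ e) * C) * (v ⬝ᵥ w) + ((w ⬝ᵥ e) * C) ^ 2 * (w ⬝ᵥ w)
          - ((v ⬝ᵥ e) * C + ((w ⬝ᵥ e) * C) ^ 2) ^ 2) := by
  have hge : g ⬝ᵥ e = 0 := by rw [dotProduct_comm, heg]
  have hunit : ∀ S : ℝ, C ^ 2 + S ^ 2 = 1 → (C • e + S • g) ⬝ᵥ (C • e + S • g) = 1 := fun S hS => by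
    simp only [add_dotProduct, dotProduct_add, smul_dotProduct, dotProduct_smul, smul_eq_mul, he,
      hg, heg, hge]
    linarith
  have h1 := h _ (hunit S hCS)
  have h2 := h _ (hunit (-S) (by rw [neg_sq, hCS]))
  simp only [CurvatureEquation, dotProduct_add, dotProduct_smul, smul_eq_mul, hvg, hwg, map_add,
    map_smul, hwe, smul_zero, zero_add, mul_zero, add_zero] at h1 h2
  linear_combination (1 / 2) * (h1 + h2)

/-- If `w ≠ 0`, the coefficients of degree four, three and two on a great circle through `w` give
`K = 6`, `v · w = 0` and `E - |w|² = -2 N - s²`, which contradicts the bounds on `E` and `N`. -/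
theorem axial_eq_zero_of_curvatureEquation {K E N s : ℝ} {v w : Fin 3 → ℝ}
    (h : ∀ x, x ⬝ᵥ x = 1 → CurvatureEquation K E N s v w x)
    (hE : N ≤ E) (hN : 2 * (w ⬝ᵥ w) ≤ 3 * N) : w = 0 := by
  by_contra hw
  have hpos : 0 < w ⬝ᵥ w := by simpa using (Matrix.dotProduct_star_self_pos_iff (v := w)).mpr hw
  obtain ⟨g, hg, hvg, hwg⟩ := exists_unit_orthogonal v w
  set a := √(w ⬝ᵥ w) with ha
  have ha0 : a ≠ 0 := (Real.sqrt_pos.mpr hpos).ne'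
  have ha2 : w ⬝ᵥ w = a ^ 2 := (Real.sq_sqrt hpos.le).symm
  have hwe : w ⬝ᵥ (a⁻¹ • w) = a := by
    rw [dotProduct_smul, ha2, smul_eq_mul]; field_simp
  have hc := @curvatureEquation_greatCircle K E N s v w (a⁻¹ • w) g h
    (by rw [smul_dotProduct, hwe, smul_eq_mul, inv_mul_cancel₀ ha0]) hg
    (by rw [smul_dotProduct, hwg, smul_zero]) hvg hwg (by rw [map_smul, cross_self, smul_zero])
  have hvw : v ⬝ᵥ w = a * (v ⬝ᵥ (a⁻¹ • w)) := by
    rw [dotProduct_smul, smul_eq_mul, mul_inv_cancel_left₀ ha0]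
  rw [hwe, hvw] at hc
  generalize v ⬝ᵥ (a⁻¹ • w) = p at hc
  rw [ha2] at hc hN hpos
  obtain ⟨-, -, h2, h3, h4⟩ := @quartic_coeff_eq_zero
    ((K - 2) * (E - a ^ 2) ^ 2 + (4 * N - 2 * s ^ 2 + 2 * a ^ 2) * (E - a ^ 2) - 4 * s ^ 2 * a ^ 2
      - 2 * (v ⬝ᵥ v))
    ((K - 2) * (4 * p * (E - a ^ 2)) + (4 * N - 2 * s ^ 2 + 2 * a ^ 2) * (2 * p) - 4 * a ^ 2 * p)
    ((K - 2) * (4 * p ^ 2 + 2 * a ^ 2 * (E - a ^ 2)) + (4 * N - 2 * s ^ 2 + 2 * a ^ 2) * a ^ 2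
      - 6 * a ^ 2 * (E - a ^ 2) + 4 * s ^ 2 * a ^ 2 - 2 * a ^ 4 + 2 * p ^ 2)
    ((K - 2) * (4 * p * a ^ 2) - 12 * a ^ 2 * p + 4 * p * a ^ 2)
    ((K - 2) * a ^ 4 - 6 * a ^ 4 + 2 * a ^ 4)
    (fun C S hCS => by linear_combination hc hCS)
  have hK : K = 6 := by
    have : (K - 6) * a ^ 4 = 0 := by linear_combination h4
    have := (mul_eq_zero.mp this).resolve_right (pow_ne_zero 4 ha0)
    linarith
  subst hK
  have hp : p = 0 := by
    have : p * (8 * a ^ 2) = 0 := by linear_combination h3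
    exact (mul_eq_zero.mp this).resolve_right (by positivity)
  subst hp
  have h5 : a ^ 2 * (2 * (E - a ^ 2) + 4 * N + 2 * s ^ 2) = 0 := by linear_combination h2
  have h6 := (mul_eq_zero.mp h5).resolve_left hpos.ne'
  nlinarith [sq_nonneg s]

/-- If `v ≠ 0`, the coefficients on a great circle through `v` give `K = 3 / 2`, `d = 3 c + s²` and
`(s² + c + d)² = 4 |v|²`, while the Cauchy–Schwarz bound `hv` says `|v|² ≤ c d`; together they
force `c = 0` and `v = 0`. -/
theorem drift_eq_zero_of_curvatureEquation {K s c d : ℝ} {v : Fin 3 → ℝ}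
    (h : ∀ x, x ⬝ᵥ x = 1 → CurvatureEquation K (s ^ 2 + c + d) (s ^ 2 + c) s v 0 x)
    (hc : 0 ≤ c) (hd : 0 ≤ d) (hv : (v ⬝ᵥ v) ^ 2 ≤ c * (v ⬝ᵥ v) * d) : v = 0 := by
  by_contra hv0
  have hpos : 0 < v ⬝ᵥ v := by simpa using (Matrix.dotProduct_star_self_pos_iff (v := v)).mpr hv0
  obtain ⟨g, hg, hvg, -⟩ := exists_unit_orthogonal v v
  set a := √(v ⬝ᵥ v) with ha
  have ha0 : a ≠ 0 := (Real.sqrt_pos.mpr hpos).ne'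
  have ha2 : v ⬝ᵥ v = a ^ 2 := (Real.sq_sqrt hpos.le).symm
  have hve : v ⬝ᵥ (a⁻¹ • v) = a := by
    rw [dotProduct_smul, ha2, smul_eq_mul]; field_simp
  have hcirc := @curvatureEquation_greatCircle K (s ^ 2 + c + d) (s ^ 2 + c) s v 0 (a⁻¹ • v) g h
    (by rw [smul_dotProduct, hve, smul_eq_mul, inv_mul_cancel₀ ha0]) hg
    (by rw [smul_dotProduct, hvg, smul_zero]) hvg (zero_dotProduct g) (by simp)
  rw [hve] at hcirc
  simp only [zero_dotProduct, dotProduct_zero] at hcirc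
  rw [ha2] at hcirc hv hpos
  obtain ⟨h0, h1, h2, -, -⟩ := @quartic_coeff_eq_zero
    ((K - 2) * (s ^ 2 + c + d) ^ 2 + (4 * (s ^ 2 + c) - 2 * s ^ 2) * (s ^ 2 + c + d) - 2 * a ^ 2)
    ((K - 2) * (4 * a * (s ^ 2 + c + d)) + (4 * (s ^ 2 + c) - 2 * s ^ 2) * (2 * a))
    ((K - 2) * (4 * a ^ 2) + 2 * a ^ 2) 0 0
    (fun C S hCS => by linear_combination hcirc hCS)
  have hK : K = 3 / 2 := by
    have : a ^ 2 * (4 * K - 6) = 0 := by linear_combination h2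
    have := (mul_eq_zero.mp this).resolve_left hpos.ne'
    linarith
  subst hK
  have h3 : s ^ 2 + c + d = 4 * (s ^ 2 + c) - 2 * s ^ 2 := by
    have : a * (4 * (s ^ 2 + c) - 2 * s ^ 2 - (s ^ 2 + c + d)) = 0 := by linear_combination h1 / 2
    have := (mul_eq_zero.mp this).resolve_left ha0
    linarith
  have h4 : (s ^ 2 + c + d) ^ 2 = 4 * a ^ 2 := by rw [← h3] at h0; linarith
  have h5 : a ^ 2 ≤ c * d := by
    have : a ^ 2 * a ^ 2 ≤ a ^ 2 * (c * d) := by linarith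
    exact le_of_mul_le_mul_left this hpos
  have hd' : d = 3 * c + s ^ 2 := by linarith
  subst hd'
  -- insert `d` into `(s² + c + d)² ≤ 4 c d`
  have h6 : 4 * c ^ 2 + 12 * (c * s ^ 2) + 4 * (s ^ 2) ^ 2 ≤ 0 := by linarith
  have h7 : 0 ≤ c * s ^ 2 := mul_nonneg hc (sq_nonneg s)
  have hc0 : c = 0 := by
    have : c ^ 2 ≤ 0 := by linarith [sq_nonneg (s ^ 2)]
    exact pow_eq_zero_iff (two_ne_zero) |>.mp (le_antisymm this (sq_nonneg c))
  rw [hc0, zero_mul] at h5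
  exact h5.not_gt hpos

/-! ### Invariants of the motion -/

namespace EquiformMotion

variable (M : EquiformMotion)

/-- Each `Ω eᵢ`, `i = 1, 2, 3`, has squared length `M.dilation`, and the components of these vectors
in the space of the first three coordinates contribute `2 |w|²` to the sum of the three. -/
theorem two_mul_axial_le (hM : M.FoliatedBySpheres) :
    2 * (M.axial ⬝ᵥ M.axial) ≤ 3 * M.dilation := by
  obtain ⟨-, -, -, n01, n02⟩ := hM
  simp only [show Finset.Icc 2 6 = {2, 3, 4, 5, 6} from rfl,
    show Finset.Icc 3 6 = {3, 4, 5, 6} from rfl, show Finset.Icc 7 11 = {7, 8, 9, 10, 11} from rfl,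
    show Finset.Icc 12 15 = {12, 13, 14, 15} from rfl] at n01 n02
  simp at n01 n02
  simp [dilation, axial, dotProduct, Fin.sum_univ_three,
    show Finset.Icc 2 6 = {2, 3, 4, 5, 6} from rfl]
  nlinarith [sq_nonneg (M.ω 3), sq_nonneg (M.ω 4), sq_nonneg (M.ω 5), sq_nonneg (M.ω 6),
    sq_nonneg (M.ω 8), sq_nonneg (M.ω 9), sq_nonneg (M.ω 10), sq_nonneg (M.ω 11),
    sq_nonneg (M.ω 12), sq_nonneg (M.ω 13), sq_nonneg (M.ω 14), sq_nonneg (M.ω 15)]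

theorem dilation_nonneg : 0 ≤ M.dilation :=
  add_nonneg (sq_nonneg _) (Finset.sum_nonneg fun _ _ => sq_nonneg _)

theorem speedSq_nonneg : 0 ≤ M.speedSq := Finset.sum_nonneg fun _ _ => sq_nonneg _

/-- The Cauchy–Schwarz inequality for `Ω v` and `d'`, where `v` is the drift: `Ω v · d' = |v|²` and
`|Ω v|² = M.dilation * |v|²`. -/
theorem drift_sq_le (hM : M.FoliatedBySpheres) (hb : M.b' 1 = 0 ∧ M.b' 2 = 0 ∧ M.b' 3 = 0) :
    (M.drift ⬝ᵥ M.drift) ^ 2 ≤ M.dilation * (M.drift ⬝ᵥ M.drift) * M.speedSq := by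
  have h := Finset.sum_mul_sq_le_sq_mul_sq Finset.univ (M.Ω *ᵥ embed M.drift) M.d'
  have h1 := M.Ω_dotProduct_d' hb M.drift
  have h2 := M.Ω_dotProduct_Ω hM M.drift M.drift
  have h3 := M.d'_dotProduct_d' hb
  rw [← h2, ← h3, ← h1]
  simpa only [dotProduct, pow_two] using h

end EquiformMotion

end Kinematic

theorem mainTheorem2 (M : Kinematic.EquiformMotion) (hM : M.FoliatedBySpheres)
    (hb : M.b' 1 = 0 ∧ M.b' 2 = 0 ∧ M.b' 3 = 0)
    (K : ℝ) (hK : M.HasConstantScalarCurvature K) :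
    (M.ω 1 = 0 ∧ M.ω 2 = 0 ∧ M.ω 7 = 0) ∧
    (∑ i ∈ Finset.Icc 4 7, M.b' i * M.ω (i - 1) = 0 ∧
      ∑ i ∈ Finset.Icc 4 7, M.b' i * M.ω (i + 4) = 0 ∧
      ∑ i ∈ Finset.Icc 4 7, M.b' i * M.ω (i + 8) = 0) ∧
    0 < M.s' ^ 2 + ∑ i ∈ Finset.Icc 3 6, M.ω i ^ 2 + ∑ i ∈ Finset.Icc 4 7, M.b' i ^ 2 ∧
    K = 2 * (∑ i ∈ Finset.Icc 4 7, M.b' i ^ 2 - ∑ i ∈ Finset.Icc 3 6, M.ω i ^ 2) /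
      (M.s' ^ 2 + ∑ i ∈ Finset.Icc 3 6, M.ω i ^ 2 + ∑ i ∈ Finset.Icc 4 7, M.b' i ^ 2) := by
  simp only [Kinematic.EquiformMotion.HasConstantScalarCurvature,
    Kinematic.EquiformMotion.RegularAt, M.firstForm_surface hM hb] at hK
  obtain ⟨hreg, hK⟩ := hK
  have heq := Kinematic.curvatureEquation_of_regular hreg hK
  have hc := M.dilation_nonneg
  have hd := M.speedSq_nonneg
  have hw : M.axial = 0 := Kinematic.axial_eq_zero_of_curvatureEquation heq (by linarith)
    (by linarith [M.two_mul_axial_le hM, sq_nonneg M.s'])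
  rw [hw] at heq hreg
  have hv : M.drift = 0 :=
    Kinematic.drift_eq_zero_of_curvatureEquation heq hc hd (M.drift_sq_le hM hb)
  rw [hv] at heq hreg
  have hω : M.ω 1 = 0 ∧ M.ω 2 = 0 ∧ M.ω 7 = 0 :=
    ⟨neg_eq_zero.mp (congrFun hw 2), congrFun hw 1, neg_eq_zero.mp (congrFun hw 0)⟩
  have hdil : M.dilation = ∑ i ∈ Finset.Icc 3 6, M.ω i ^ 2 := by
    rw [Kinematic.EquiformMotion.dilation, hω.1, ← Finset.add_sum_Ioc_eq_sum_Icc (by norm_num),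
      hω.2.1]
    simp
    rfl
  refine ⟨hω, ⟨neg_eq_zero.mp (congrFun hv 0), neg_eq_zero.mp (congrFun hv 1),
    neg_eq_zero.mp (congrFun hv 2)⟩, ?_⟩
  change 0 < M.s' ^ 2 + _ + M.speedSq ∧
    K = 2 * (M.speedSq - _) / (M.s' ^ 2 + _ + M.speedSq)
  rw [← hdil]
  have hE : M.s' ^ 2 + M.dilation + M.speedSq ≠ 0 := by
    obtain ⟨θ, φ, h⟩ := hreg
    rw [Kinematic.det_modelMetric_zero] at h
    simpa [Kinematic.lapseSq, Kinematic.radial, Kinematic.east, Kinematic.north] using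
      right_ne_zero_of_mul h
  refine ⟨lt_of_le_of_ne (by positivity) hE.symm, ?_⟩
  -- for `v = w = 0` the curvature equation does not depend on the point of the sphere
  have h := heq ![1, 0, 0] (by simp [dotProduct, Fin.sum_univ_three])
  simp only [Kinematic.CurvatureEquation, zero_dotProduct] at h
  rw [eq_div_iff hE]
  refine mul_right_cancel₀ hE ?_
  linear_combination h
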